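/- For a graph $G$ with vertex set $[n]$ and $A\subseteq[n]$ let $G+C(A)$ be the graph obtained from $G$ by adding all edges between distinct vertices of $A$. For $0\le p\le 1$ and $c\le n$ write $(G,A)\in \mathrm{ER}(n,p,c)$ for a random pair in which $G$ is a random graph on $[n]$, each of the $\binom n2$ potential edges being present independently with probability $p$, and $A$ is, independently of $G$, a uniformly random $c$-element subset of $[n]$. Boolean circuits are finite directed acyclic graphs of $\wedge$- and $\vee$-gates of unbounded fan-in, $\neg$-gates, variables and constants, with one output gate; the size of a circuit is its number of gates, and its depth is the length of a longest directed path. A circuit that is evaluated on graphs with vertex set $[n]$ has one variable for each of the $\binom n2$ potential edges, which is $1$ if and only if the edge is present. **Theorem.** Let $k:\mathbb N\to\mathbb R$ be positive-valued with $\lim_{n\to\infty}k(n)=\infty$, and let $c:\mathbb N\to\mathbb N$ satisfy $c(n)\le n^{\xi}$ for all $n$, for some fixed $0\le \xi<1$. Let $(\mathsf C_n)_{n\in\mathbb N}$ be a (not necessarily uniform) family of circuits, with $\mathsf C_n$ evaluated on graphs with vertex set $[n]$, such that the depth of $\mathsf C_n$ is bounded by a constant independent of $n$ and the size of $\mathsf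 C_n$ is at most $n^{O(1)}$. Then $$\lim_{n\to\infty}\ \Pr_{(G,A)\in \mathrm{ER}(n,\,n^{-1/k(n)},\,c(n))}\big[\mathsf C_n(G)=\mathsf C_n(G+C(A))\big]=1 .$$ -/

import Mathlib

open MeasureTheory ProbabilityTheory Filter Topology

/-- A gate of a Boolean circuit whose variables are indexed by `X` and whose nodes are indexed
by `N`: a variable, a constant, a negation of one node, or a conjunction / disjunction of
an arbitrary finite set of nodes (unbounded fan-in). -/
inductive BoolGate (X N : Type) : Type
  | var (x : X) : BoolGate X N
  | const (b : Bool) : BoolGate X N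
  | neg (h : N) : BoolGate X N
  | conj (S : Finset N) : BoolGate X N
  | disj (S : Finset N) : BoolGate X N

/-- The nodes from which there is a wire into the given gate. -/
def BoolGate.inputs {X N : Type} : BoolGate X N → Finset N
  | .var _ => ∅
  | .const _ => ∅
  | .neg h => {h}
  | .conj S => S
  | .disj S => S

/-- A Boolean circuit with one output gate: a finite directed acyclic graph of labelled gates. -/
structure BoolCircuit (X : Type) where
  /-- the number of gates (variable and constant nodes are counted too) -/
  size : ℕ
  /-- the label and the in-neighbours of every node -/
  gate : Fin size → BoolGate X (Fin size)
  /-- there is no directed cycle -/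
  acyclic : ∀ g, ¬ Relation.TransGen (fun h g => h ∈ (gate g).inputs) g g
  /-- the output gate -/
  output : Fin size

namespace BoolCircuit

variable {X : Type}

/-- There is a wire from `h` to `g`. -/
def Wire (C : BoolCircuit X) (h g : Fin C.size) : Prop := h ∈ (C.gate g).inputs

theorem wire_wf (C : BoolCircuit X) : WellFounded C.Wire := by
  have : Std.Irrefl (Relation.TransGen C.Wire) := ⟨C.acyclic⟩
  exact Subrelation.wf (fun h => Relation.TransGen.single h)
    (Finite.wellFounded_of_trans_of_irrefl (Relation.TransGen C.Wire))

/-- The value of every gate under the assignment `x`. -/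
def gateValue (C : BoolCircuit X) (x : X → Bool) : Fin C.size → Bool :=
  C.wire_wf.fix fun g ih =>
    match hg : C.gate g with
    | .var v => x v
    | .const b => b
    | .neg h => ! ih h (by simp [Wire, hg, BoolGate.inputs])
    | .conj S => decide (∀ h : S, ih h (by simp [Wire, hg, BoolGate.inputs]) = true)
    | .disj S => decide (∃ h : S, ih h (by simp [Wire, hg, BoolGate.inputs]) = true)

/-- The function computed by the circuit. -/
def eval (C : BoolCircuit X) (x : X → Bool) : Bool := C.gateValue x C.output

/-- The length (number of wires) of a longest directed path ending in a given gate. -/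
def gateDepth (C : BoolCircuit X) : Fin C.size → ℕ :=
  C.wire_wf.fix fun g ih =>
    (C.gate g).inputs.attach.sup fun h => ih h.1 h.2 + 1

/-- The depth of the circuit: the length of a longest directed path. -/
def depth (C : BoolCircuit X) : ℕ := Finset.univ.sup C.gateDepth

/-- The recursion that defines the values of the gates. -/
theorem gateValue_eq (C : BoolCircuit X) (x : X → Bool) (g : Fin C.size) :
    C.gateValue x g =
      match C.gate g with
      | .var v => x v
      | .const b => b
      | .neg h => ! C.gateValue x h
      | .conj S => decide (∀ h ∈ S, C.gateValue x h = true)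
      | .disj S => decide (∃ h ∈ S, C.gateValue x h = true) := by
  rw [gateValue, WellFounded.fix_eq]
  split <;> rename_i hg <;> simp [hg]

/-- The recursion that defines the depths of the gates. -/
theorem gateDepth_eq (C : BoolCircuit X) (g : Fin C.size) :
    C.gateDepth g = (C.gate g).inputs.sup fun h => C.gateDepth h + 1 := by
  rw [gateDepth, WellFounded.fix_eq]
  exact Finset.sup_attach (C.gate g).inputs fun h => C.gateDepth h + 1

end BoolCircuit

/-- The potential edges of a graph with vertex set `Fin n`, i.e. the 2-element subsets of
`Fin n`. There is one Boolean variable for each of them. -/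
abbrev PotentialEdge (n : ℕ) : Type := {e : Sym2 (Fin n) // ¬ e.IsDiag}

open Classical in
/-- The assignment that encodes the graph `G`: the variable of `e` is true iff `e` is an edge. -/
noncomputable def graphAssignment {n : ℕ} (G : SimpleGraph (Fin n)) : PotentialEdge n → Bool :=
  fun e => decide (e.1 ∈ G.edgeSet)

/-- The output of a circuit on a graph. -/
noncomputable def BoolCircuit.evalGraph {n : ℕ} (C : BoolCircuit (PotentialEdge n))
    (G : SimpleGraph (Fin n)) : Bool := C.eval (graphAssignment G)

/-- `C n` (for `n`-vertex graphs) is a family of circuits of bounded depth and polynomial size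
`n ^ O(1)`. No uniformity is required. -/
def IsACZeroFamily (C : ∀ n : ℕ, BoolCircuit (PotentialEdge n)) : Prop :=
  (∃ d : ℕ, ∀ n, (C n).depth ≤ d) ∧ ∃ t : ℕ, ∀ᶠ n : ℕ in atTop, (C n).size ≤ n ^ t

/-- `G + C(A)`: the graph obtained from `G` by adding all edges inside `A`. -/
def plantClique {V : Type} (G : SimpleGraph V) (A : Finset V) : SimpleGraph V where
  Adj u v := G.Adj u v ∨ (u ≠ v ∧ u ∈ A ∧ v ∈ A)
  symm := ⟨fun _ _ h => h.imp (fun h => G.adj_symm h) fun h => ⟨h.1.symm, h.2.2, h.2.1⟩⟩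
  loopless := ⟨fun _ h => h.elim (fun h => h.ne rfl) fun h => h.1 rfl⟩

/-- The edge probability `n ^ (-1 / x)`. -/
noncomputable def edgeProb (n : ℕ) (x : ℝ) (hx : 0 < x) : unitInterval :=
  ⟨(n : ℝ) ^ (-1 / x), by
    rcases Nat.eq_zero_or_pos n with rfl | hn
    · have h : -1 / x ≠ 0 := div_ne_zero (by norm_num) hx.ne'
      simp [Real.zero_rpow h]
    · exact ⟨Real.rpow_nonneg (Nat.cast_nonneg n) _,
        Real.rpow_le_one_of_one_le_of_nonpos (by exact_mod_cast hn)
          (div_nonpos_of_nonpos_of_nonneg (by norm_num) hx.le)⟩⟩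

/-- The joint law of `(G, A)`: `G` is a binomial (Erdős–Rényi) random graph on `Fin n` with edge
probability `p`, and `A`, independent of `G`, is a uniformly random `c`-element subset of
`Fin n`. -/
noncomputable def plantedLaw (n : ℕ) (p : unitInterval) (c : ℕ) :
    Measure (SimpleGraph (Fin n) × Finset (Fin n)) :=
  (SimpleGraph.binomialRandom (Fin n) p).prod (uniformOn {A : Finset (Fin n) | A.card = c})

/-! The clique is reached through a chain of random vertex sets of sizes about n^(1-iε), i ≤ d, with
`A` uniform inside the last. At each stage the edges inside the current set are free and all others
are fixed according to the random graph. With high probability, once the i-th set is reached, every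
gate of depth at most i has a certificate of bounded size at every input. At the end the output has
one at the random graph itself. Planting changes only edges inside `A`, and a bounded certificate
rarely contains such an edge.

A further layer of gates keeps certificates for one output value only; `switching_lemma` restores
both. It uses Razborov's encoding: a bad restriction is recovered, up to the values on a bounded set
of at least s free edges, from a modified assignment and boundedly many bits (`exists_encoding`).
Those edges depend on the code alone, so the chance that all of them lie in the random free set can
be bounded for each code separately. With s = τ² they span at least τ vertices, which gives ρ^τ,
where ρ is the shrinking factor. Modifying the assignment costs a factor of about n^(δs²) in
probability; a small δ and then τ large compared with the size exponent make the union bound over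
gates work.

The switching step needs an edge density away from 0 and 1 on the scale n^(-δ). As n^(-1/k) may be
close to 1, the random graph is split into a union of two independent ones, of which the second has
density n^(-δ). The first is absorbed into the circuit (`gateFunction`, `sum_bernoulliWeight_or`).
-/

open scoped BigOperators

/-! ### Certificates of Boolean functions -/

section Certificates

variable {X : Type}

/-- The value of `f` at `x` is determined by the values of `r` coordinates of `x`. -/
def HasCertificate (f : (X → Bool) → Bool) (r : ℕ) (x : X → Bool) : Prop :=
  ∃ v : Fin r → X, ∀ y : X → Bool, (∀ i, y (v i) = x (v i)) → f y = f x

theorem HasCertificate.not {f : (X → Bool) → Bool} {r : ℕ} {x : X → Bool}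
    (h : HasCertificate f r x) : HasCertificate (fun y => !f y) r x := by
  obtain ⟨v, hv⟩ := h
  exact ⟨v, fun y hy => congrArg _ (hv y hy)⟩

/-- Unused positions of the certificate repeat an arbitrary coordinate. -/
theorem hasCertificate_of_finset [Nonempty X] {f : (X → Bool) → Bool} {s : ℕ} {x : X → Bool}
    (D : Finset X) (hD : D.card ≤ s)
    (h : ∀ y : X → Bool, (∀ e ∈ D, y e = x e) → f y = f x) : HasCertificate f s x := by
  classical
  refine ⟨fun i => if hi : i.1 < D.card then (D.equivFin.symm ⟨i.1, hi⟩ : X)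
    else Classical.arbitrary X, fun y hy => h y fun e he => ?_⟩
  have h1 := hy ⟨(D.equivFin ⟨e, he⟩).1, (D.equivFin ⟨e, he⟩).2.trans_le hD⟩
  simpa using h1

end Certificates

/-! ### Razborov's encoding of bad restrictions -/

section Switching

variable {X : Type} [Fintype X] [DecidableEq X]

/-- A conjunction of `r` literals. -/
abbrev Term (X : Type) (r : ℕ) : Type := (Fin r → X) × (Fin r → Bool)

/-- The assignment `z` satisfies all literals of the term. -/
def Term.Sat {r : ℕ} (T : Term X r) (z : X → Bool) : Prop := ∀ i, z (T.1 i) = T.2 i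

/-- All assignments that satisfy the term are mapped to `true`. -/
def Term.Implies {r : ℕ} (T : Term X r) (f : (X → Bool) → Bool) : Prop :=
  ∀ z, T.Sat z → f z = true

/-- The position of a term in a fixed enumeration. -/
noncomputable def Term.rank {r : ℕ} (T : Term X r) : ℕ := (Fintype.equivFin (Term X r) T).1

omit [DecidableEq X] in
theorem Term.rank_injective {r : ℕ} : Function.Injective (Term.rank : Term X r → ℕ) := by
  classical
  exact fun T T' h => (Fintype.equivFin (Term X r)).injective (Fin.ext h)

/-- `T` is the first implicant of `f` with the property `P`. -/
def IsFirst {r : ℕ} (f : (X → Bool) → Bool) (P : Term X r → Prop) (T : Term X r) : Prop :=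
  T.Implies f ∧ P T ∧ ∀ T' : Term X r, T'.Implies f → P T' → T.rank ≤ T'.rank

omit [DecidableEq X] in
theorem IsFirst.unique {r : ℕ} {f : (X → Bool) → Bool} {P : Term X r → Prop} {T T' : Term X r}
    (h : IsFirst f P T) (h' : IsFirst f P T') : T = T' :=
  Term.rank_injective (le_antisymm (h.2.2 T' h'.1 h'.2.1) (h'.2.2 T h.1 h.2.1))

omit [DecidableEq X] in
theorem exists_isFirst {r : ℕ} {f : (X → Bool) → Bool} {P : Term X r → Prop}
    (h : ∃ T : Term X r, T.Implies f ∧ P T) : ∃ T, IsFirst f P T := by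
  classical
  obtain ⟨T, hT, hmin⟩ := Finset.exists_min_image
    (Finset.univ.filter fun T : Term X r => T.Implies f ∧ P T) Term.rank
    (by obtain ⟨T, hT⟩ := h; exact ⟨T, by simpa using hT⟩)
  simp only [Finset.mem_filter, Finset.mem_univ, true_and] at hT hmin
  exact ⟨T, hT.1, hT.2, fun T' h1 h2 => hmin T' ⟨h1, h2⟩⟩

/-- Overwrite `z` at the coordinates `v i`, `i ∈ M`, by the bits `β i`. -/
noncomputable def overwrite {r : ℕ} (v : Fin r → X) (M : Finset (Fin r)) (β : Fin r → Bool)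
    (z : X → Bool) : X → Bool := by
  classical
  exact fun e => if h : ∃ i ∈ M, v i = e then β h.choose else z e

omit [Fintype X] in
theorem overwrite_of_mem {r : ℕ} {v : Fin r → X} {M : Finset (Fin r)} {x z : X → Bool} {e : X}
    (he : e ∈ M.image v) : overwrite v M (fun i => x (v i)) z e = x e := by
  have h : ∃ i ∈ M, v i = e := by simpa using he
  rw [overwrite, dif_pos h, h.choose_spec.2]

omit [Fintype X] in
theorem overwrite_of_notMem {r : ℕ} {v : Fin r → X} {M : Finset (Fin r)} {β : Fin r → Bool}
    {z : X → Bool} {e : X} (he : e ∉ M.image v) : overwrite v M β z e = z e := by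
  have h : ¬ ∃ i ∈ M, v i = e := by simpa using he
  rw [overwrite, dif_neg h]

/-- The auxiliary information for one step of the decoding: the positions of the free variables
in the current term, and their new values. -/
abbrev Advice (r : ℕ) : Type := Finset (Fin r) × (Fin r → Bool)

open Classical in
/-- Decode the set of the free variables that were met on the canonical path. -/
noncomputable def decodeVars {r : ℕ} (f : (X → Bool) → Bool) :
    List (Advice r) → (X → Bool) → Finset X
  | [], _ => ∅
  | a :: l, z =>
    if h : ∃ T : Term X r, IsFirst f (fun T => T.Sat z) T then
      a.1.image h.choose.1 ∪ decodeVars f l (overwrite h.choose.1 a.1 a.2 z)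
    else ∅

theorem decodeVars_cons {r : ℕ} {f : (X → Bool) → Bool} {a : Advice r} {l : List (Advice r)}
    {z : X → Bool} {T : Term X r} (h : IsFirst f (fun T => T.Sat z) T) :
    decodeVars f (a :: l) z = a.1.image T.1 ∪ decodeVars f l (overwrite T.1 a.1 a.2 z) := by
  have hex : ∃ T : Term X r, IsFirst f (fun T => T.Sat z) T := ⟨T, h⟩
  have hT : hex.choose = T := hex.choose_spec.unique h
  rw [decodeVars, dif_pos hex, hT]

/-- Each step adds variables of one term. The bound limits how far the weights of the restriction
and of its code can differ. -/
theorem card_decodeVars_le {r : ℕ} (f : (X → Bool) → Bool) (l : List (Advice r)) (z : X → Bool) :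
    (decodeVars f l z).card ≤ r * l.length := by
  induction l generalizing z with
  | nil => simp [decodeVars]
  | cons a l ih =>
    rw [decodeVars]
    split_ifs with h
    · refine (Finset.card_union_le _ _).trans ?_
      have h1 : (a.1.image h.choose.1).card ≤ r :=
        Finset.card_image_le.trans ((Finset.card_le_univ _).trans (by simp))
      have h2 := ih (overwrite h.choose.1 a.1 a.2 z)
      rw [List.length_cons, mul_add, mul_one]
      omega
    · simp

/-- Empty advice serves as padding, so that all codes have the same length. -/
theorem decodeVars_replicate {r : ℕ} (f : (X → Bool) → Bool) (j : ℕ) (z : X → Bool) :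
    decodeVars f (List.replicate j ((∅, fun _ => false) : Advice r)) z = ∅ := by
  induction j generalizing z with
  | zero => simp [decodeVars]
  | succ j ih =>
    rw [List.replicate_succ, decodeVars]
    split_ifs with h
    · simp [ih]
    · rfl

/-- The induction behind the encoding of bad restrictions: `D` is the set of free variables that
were already queried. -/
theorem exists_encoding_aux [Nonempty X] {r s : ℕ} {f : (X → Bool) → Bool}
    (hf : ∀ x, f x = true → HasCertificate f r x) {S : Finset X} {G x : X → Bool}
    (hbad : ¬ HasCertificate (fun y => f (S.piecewise y G)) s x) (j : ℕ) :
    ∀ D ⊆ S, s ≤ D.card + j → ∃ (l : List (Advice r)) (z : X → Bool), l.length = j ∧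
      (∀ e ∈ D, z e = x e) ∧
      (∀ e, e ∉ D → e ∉ decodeVars f l z → z e = G e) ∧ decodeVars f l z ⊆ S \ D ∧
      s ≤ (D ∪ decodeVars f l z).card := by
  induction j with
  | zero =>
    intro D _ hs
    exact ⟨[], D.piecewise x G, rfl, fun e he => by simp [he], fun e he _ => by simp [he],
      by simp [decodeVars], by simpa [decodeVars] using hs⟩
  | succ j ih =>
    intro D hDS hs
    by_cases hD : s ≤ D.card
    · refine ⟨List.replicate (j + 1) (∅, fun _ => false), D.piecewise x G, by simp,
        fun e he => by simp [he], fun e he _ => by simp [he], ?_, ?_⟩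
      · simp [decodeVars_replicate]
      · simpa [decodeVars_replicate] using hD
    · -- the partial assignment that is known so far is not a certificate
      have hnc : ∃ y : X → Bool, (∀ e ∈ D, y e = x e) ∧
          f (S.piecewise y G) ≠ f (S.piecewise x G) := by
        by_contra! hcon
        exact hbad (hasCertificate_of_finset D (by omega) hcon)
      obtain ⟨y, hyD, hyne⟩ := hnc
      -- the term is compatible with the partial assignment
      let P : Term X r → Prop := fun T =>
        ∃ w : X → Bool, (∀ e ∉ S, w e = G e) ∧ (∀ e ∈ D, w e = x e) ∧ T.Sat w
      -- The values at `x` and `y` differ, so one of them is `true`; only there does `hf` provide a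
      -- certificate, which yields an implicant.
      have key : ∃ w : X → Bool, (∀ e ∈ D, w e = x e) ∧ f (S.piecewise w G) = true := by
        by_cases hx : f (S.piecewise x G) = true
        · exact ⟨x, fun _ _ => rfl, hx⟩
        · refine ⟨y, hyD, ?_⟩
          cases h1 : f (S.piecewise y G) <;> simp_all
      obtain ⟨w, hwD, hw⟩ := key
      obtain ⟨v, hv⟩ := hf _ hw
      obtain ⟨T, hT⟩ : ∃ T, IsFirst f P T := by
        refine exists_isFirst ⟨(v, fun i => S.piecewise w G (v i)), fun z hz => ?_,
          S.piecewise w G, fun e he => by simp [he], fun e he => ?_, fun i => rfl⟩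
        · rw [hv z hz, hw]
        · rw [Finset.piecewise_eq_of_mem _ _ _ (hDS he), hwD e he]
      obtain ⟨u, huS, huD, huT⟩ := hT.2.1
      let M : Finset (Fin r) := Finset.univ.filter fun i => T.1 i ∈ S ∧ T.1 i ∉ D
      let N : Finset X := M.image T.1
      have hNS : N ⊆ S \ D := by
        intro e he
        obtain ⟨i, hi, rfl⟩ := Finset.mem_image.1 he
        simpa [M] using hi
      have hNmem : ∀ i, T.1 i ∈ S → T.1 i ∉ D → T.1 i ∈ N := fun i h1 h2 =>
        Finset.mem_image_of_mem _ (by simp [M, h1, h2])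
      -- Without a new free variable the term would already be forced, and `f` would be `true` at
      -- both `x` and `y`. Hence every step queries at least one variable, and s steps suffice.
      have hNne : N.Nonempty := by
        by_contra hN
        rw [Finset.not_nonempty_iff_eq_empty] at hN
        have hsat : ∀ y : X → Bool, (∀ e ∈ D, y e = x e) → f (S.piecewise y G) = true := by
          intro y hy
          refine hT.1 _ fun i => ?_
          rw [← huT i]
          by_cases hS : T.1 i ∈ S
          · by_cases hi : T.1 i ∈ D
            · rw [Finset.piecewise_eq_of_mem _ _ _ hS, hy _ hi, huD _ hi]
            · have := hNmem i hS hi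
              simp [hN] at this
          · rw [Finset.piecewise_eq_of_notMem _ _ _ hS, huS _ hS]
        exact hyne (by rw [hsat y hyD, hsat x fun _ _ => rfl])
      have hdisj : Disjoint D N := by
        rw [Finset.disjoint_left]
        intro e he he'
        exact (Finset.mem_sdiff.1 (hNS he')).2 he
      obtain ⟨l, z, hl, hzD, hzG, hdec, hcard⟩ := ih (D ∪ N)
        (Finset.union_subset hDS (hNS.trans Finset.sdiff_subset)) (by
          rw [Finset.card_union_of_disjoint hdisj]
          have := hNne.card_pos
          omega)
      -- on the new variables the term is made true
      let z' : X → Bool := N.piecewise u z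
      have hz'S : ∀ e ∉ S, z' e = G e := fun e he => by
        have heD : e ∉ D := fun h => he (hDS h)
        have heN : e ∉ N := fun h => he (Finset.mem_sdiff.1 (hNS h)).1
        have hed : e ∉ decodeVars f l z := fun h => he (Finset.mem_sdiff.1 (hdec h)).1
        simp only [z', Finset.piecewise_eq_of_notMem _ _ _ heN]
        exact hzG e (by simp [heD, heN]) hed
      have hz'D : ∀ e ∈ D, z' e = x e := fun e he => by
        have heN : e ∉ N := Finset.disjoint_left.1 hdisj he
        simp only [z', Finset.piecewise_eq_of_notMem _ _ _ heN]
        exact hzD e (Finset.mem_union_left _ he)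
      have hsat : T.Sat z' := fun i => by
        rw [← huT i]
        by_cases hi : T.1 i ∈ N
        · simp [z', hi]
        · by_cases hS : T.1 i ∈ S
          · have hiD : T.1 i ∈ D := by
              by_contra h
              exact hi (hNmem i hS h)
            rw [hz'D _ hiD, huD _ hiD]
          · rw [hz'S _ hS, huS _ hS]
      -- The decoder sees only `z'`, yet finds the same term: `z'` is compatible with the partial
      -- assignment, so any implicant it satisfies was a candidate when `T` was chosen as the first.
      have hfirst : IsFirst f (fun T => T.Sat z') T :=
        ⟨hT.1, hsat, fun T' h1 h2 => hT.2.2 T' h1 ⟨z', hz'S, hz'D, h2⟩⟩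
      -- Replacing the satisfying values by the true answers `x` returns the assignment from which
      -- the rest of the list is decoded.
      have hover : overwrite T.1 M (fun i => x (T.1 i)) z' = z := by
        funext e
        by_cases he : e ∈ N
        · rw [overwrite_of_mem he, hzD e (Finset.mem_union_right _ he)]
        · rw [overwrite_of_notMem he]
          simp [z', he]
      have hdecode : decodeVars f ((M, fun i => x (T.1 i)) :: l) z' = N ∪ decodeVars f l z := by
        rw [decodeVars_cons hfirst, hover]
      refine ⟨(M, fun i => x (T.1 i)) :: l, z', by simp [hl], hz'D, fun e he1 he2 => ?_, ?_, ?_⟩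
      · rw [hdecode, Finset.mem_union, not_or] at he2
        simp only [z', Finset.piecewise_eq_of_notMem _ _ _ he2.1]
        exact hzG e (by simp [he1, he2.1]) he2.2
      · rw [hdecode]
        refine Finset.union_subset hNS fun e he => ?_
        have := hdec he
        simp only [Finset.mem_sdiff, Finset.mem_union, not_or] at this ⊢
        exact ⟨this.1, this.2.1⟩
      · rwa [hdecode, ← Finset.union_assoc]

/-- Razborov's encoding of the restrictions under which a disjunction of small conjunctions does
not become a function with small certificates. -/
theorem exists_encoding [Nonempty X] {r s : ℕ} {f : (X → Bool) → Bool}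
    (hf : ∀ x, f x = true → HasCertificate f r x) {S : Finset X} {G : X → Bool}
    (hbad : ∃ x, ¬ HasCertificate (fun y => f (S.piecewise y G)) s x) :
    ∃ (l : Fin s → Advice r) (z : X → Bool),
      (∀ e ∉ decodeVars f (List.ofFn l) z, G e = z e) ∧ decodeVars f (List.ofFn l) z ⊆ S ∧
      s ≤ (decodeVars f (List.ofFn l) z).card := by
  obtain ⟨x, hx⟩ := hbad
  obtain ⟨l, z, hl, -, hG, hS, hs⟩ := exists_encoding_aux hf hx s ∅ (by simp) (by simp)
  subst hl
  refine ⟨l.get, z, ?_⟩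
  rw [List.ofFn_get]
  exact ⟨fun e he => (hG e (by simp) he).symm, by simpa using hS, by simpa using hs⟩

end Switching

/-! ### Product Bernoulli weights and the switching lemma -/

section ProductWeight

/-- The indicator of a proposition. -/
noncomputable def indicator (P : Prop) : ℝ := by classical exact if P then 1 else 0

theorem indicator_eq_ite (P : Prop) [Decidable P] : indicator P = if P then 1 else 0 := by
  unfold indicator; congr

theorem indicator_of {P : Prop} (h : P) : indicator P = 1 := if_pos h

theorem indicator_of_not {P : Prop} (h : ¬ P) : indicator P = 0 := if_neg h

theorem indicator_nonneg (P : Prop) : 0 ≤ indicator P := by unfold indicator; split_ifs <;> simp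

theorem indicator_le_one (P : Prop) : indicator P ≤ 1 := by unfold indicator; split_ifs <;> simp

variable {X : Type} [Fintype X] [DecidableEq X]

/-- The mass of a bit under the Bernoulli law with parameter `p`. -/
def bitWeight (p : ℝ) (b : Bool) : ℝ := if b then p else 1 - p

/-- The mass of an assignment under the product of Bernoulli laws with parameter `p`. -/
def bernoulliWeight (p : ℝ) (x : X → Bool) : ℝ := ∏ e, bitWeight p (x e)

theorem bitWeight_nonneg {p : ℝ} (h0 : 0 ≤ p) (h1 : p ≤ 1) (b : Bool) : 0 ≤ bitWeight p b := by
  unfold bitWeight; split_ifs <;> linarith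

omit [DecidableEq X] in
theorem bernoulliWeight_nonneg {p : ℝ} (h0 : 0 ≤ p) (h1 : p ≤ 1) (x : X → Bool) :
    0 ≤ bernoulliWeight p x := Finset.prod_nonneg fun _ _ => bitWeight_nonneg h0 h1 _

/-- Combining two independent Bernoulli assignments coordinatewise. -/
theorem sum_bernoulliWeight_combine {p q r : ℝ} (m : X → Bool → Bool → Bool)
    (hm : ∀ e b, (∑ a : Bool × Bool, if m e a.1 a.2 = b then bitWeight p a.1 * bitWeight q a.2
      else 0) = bitWeight r b) (Φ : (X → Bool) → ℝ) :
    ∑ x, bernoulliWeight p x * ∑ y, bernoulliWeight q y * Φ (fun e => m e (x e) (y e)) =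
      ∑ z, bernoulliWeight r z * Φ z := by
  -- Expanding the product of the coordinatewise identities `hm` writes the weight of `z` as the
  -- total weight of the pairs that combine to `z`.
  have h1 : ∀ z : X → Bool, bernoulliWeight r z = ∑ a : X → Bool × Bool,
      if (fun e => m e (a e).1 (a e).2) = z then
        bernoulliWeight p (fun e => (a e).1) * bernoulliWeight q (fun e => (a e).2) else 0 := by
    intro z
    rw [bernoulliWeight, Finset.prod_congr rfl fun e _ => (hm e (z e)).symm,
      Finset.prod_univ_sum, Fintype.piFinset_univ]
    refine Finset.sum_congr rfl fun a _ => ?_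
    rw [Finset.prod_ite_zero, bernoulliWeight, bernoulliWeight, ← Finset.prod_mul_distrib]
    simp [funext_iff]
  simp_rw [h1, Finset.sum_mul]
  rw [Finset.sum_comm]
  simp_rw [ite_mul, zero_mul, Finset.sum_ite_eq, Finset.mem_univ, if_true]
  rw [← (Equiv.arrowProdEquivProdArrow X (fun _ => Bool) (fun _ => Bool)).symm.sum_comp,
    Fintype.sum_prod_type]
  refine Finset.sum_congr rfl fun x _ => ?_
  rw [Finset.mul_sum]
  exact Finset.sum_congr rfl fun y _ => (mul_assoc _ _ _).symm

theorem sum_bernoulliWeight (p : ℝ) : ∑ x : X → Bool, bernoulliWeight p x = 1 := by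
  unfold bernoulliWeight
  rw [← Fintype.piFinset_univ, ← Finset.prod_univ_sum]
  simp [bitWeight]

/-- Resampling the coordinates in `S`. -/
theorem sum_bernoulliWeight_piecewise (p : ℝ) (S : Finset X)
    (Φ : (X → Bool) → ℝ) :
    ∑ x, bernoulliWeight p x * ∑ y, bernoulliWeight p y * Φ (S.piecewise y x) =
      ∑ z, bernoulliWeight p z * Φ z := by
  refine sum_bernoulliWeight_combine (fun e a b => if e ∈ S then b else a) (fun e b => ?_) Φ
  rw [Fintype.sum_prod_type]
  by_cases he : e ∈ S <;> cases b <;> simp [he, bitWeight] <;> ring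

/-- A random set of density `p` is the union of independent random sets of densities `q`, `p'`
with `1 - p = (1 - q) * (1 - p')`. -/
theorem sum_bernoulliWeight_or {p q p' : ℝ} (h : 1 - p = (1 - q) * (1 - p'))
    (Φ : (X → Bool) → ℝ) :
    ∑ x, bernoulliWeight q x * ∑ y, bernoulliWeight p' y * Φ (fun e => x e || y e) =
      ∑ z, bernoulliWeight p z * Φ z := by
  refine sum_bernoulliWeight_combine (fun e a b => a || b) (fun e b => ?_) Φ
  rw [Fintype.sum_prod_type]
  cases b <;> simp [bitWeight] <;> linarith

/-- On `N` each factor for `z` is at least `p₀` and each factor for `G` at most 1; elsewhere the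
factors coincide. -/
theorem bernoulliWeight_mul_pow_le {p p₀ : ℝ} (h0 : 0 ≤ p₀) (hp : p₀ ≤ p) (hp' : p₀ ≤ 1 - p)
    (N : Finset X) {G z : X → Bool} (hG : ∀ e ∉ N, G e = z e) :
    bernoulliWeight p G * p₀ ^ N.card ≤ bernoulliWeight p z := by
  classical
  have h1 : p₀ ^ N.card = ∏ e : X, if e ∈ N then p₀ else 1 := by
    rw [Finset.prod_ite_mem, Finset.univ_inter, Finset.prod_const]
  rw [h1, bernoulliWeight, ← Finset.prod_mul_distrib]
  refine Finset.prod_le_prod (fun e _ => mul_nonneg (bitWeight_nonneg (by linarith) (by linarith) _)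
    (by split_ifs <;> linarith)) fun e _ => ?_
  split_ifs with he
  · have : bitWeight p (G e) ≤ 1 := by unfold bitWeight; split_ifs <;> linarith
    have h2 : p₀ ≤ bitWeight p (z e) := by unfold bitWeight; split_ifs <;> linarith
    nlinarith
  · rw [hG e he, mul_one]

/-- At most 2^|N| assignments share a code, and each outweighs `z` by at most the factor p₀^(-|N|).
-/
theorem sum_bernoulliWeight_agree_le {p p₀ : ℝ} (h0 : 0 < p₀) (hp : p₀ ≤ p) (hp' : p₀ ≤ 1 - p)
    (N : Finset X) (z : X → Bool) :
    (∑ G, bernoulliWeight p G * indicator (∀ e ∉ N, G e = z e)) ≤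
      (2 / p₀) ^ N.card * bernoulliWeight p z := by
  simp_rw [indicator, mul_ite, mul_one, mul_zero]
  rw [← Finset.sum_filter]
  have hcard : (Finset.univ.filter fun G : X → Bool => ∀ e ∉ N, G e = z e).card ≤ 2 ^ N.card := by
    rw [← Finset.card_powerset]
    refine Finset.card_le_card_of_injOn (fun G => N.filter fun e => G e = true)
      (fun G _ => Finset.mem_coe.2 (Finset.mem_powerset.2 (Finset.filter_subset _ N))) fun G hG G' hG' h => ?_
    simp only [Finset.coe_filter, Finset.mem_univ, true_and, Set.mem_ofPred_eq] at hG hG'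
    funext e
    by_cases he : e ∈ N
    · have h1 := Finset.ext_iff.1 h e
      simp only [Finset.mem_filter, he, true_and] at h1
      exact Bool.eq_iff_iff.2 h1
    · rw [hG e he, hG' e he]
  have hle : ∀ G ∈ Finset.univ.filter (fun G : X → Bool => ∀ e ∉ N, G e = z e),
      bernoulliWeight p G ≤ bernoulliWeight p z / p₀ ^ N.card := by
    intro G hG
    rw [le_div_iff₀ (by positivity)]
    exact bernoulliWeight_mul_pow_le h0.le hp hp' N (by simpa using hG)
  refine (Finset.sum_le_card_nsmul _ _ _ hle).trans ?_
  have hz := bernoulliWeight_nonneg (X := X) (p := p) (by linarith) (by linarith) z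
  rw [nsmul_eq_mul, div_pow, mul_div_assoc', div_mul_eq_mul_div]
  gcongr
  exact_mod_cast hcard

/-- The failure probability of the switching lemma. -/
noncomputable def switchingBound (r s : ℕ) (p₀ η : ℝ) : ℝ :=
  (Fintype.card (Advice r) : ℝ) ^ s * ((2 / p₀) ^ (r * s) * η)

/-- The switching lemma. -/
theorem switching_lemma [Nonempty X] {ι : Type} (I : Finset ι) (St : ι → Finset X)
    {r s : ℕ} {η p p₀ : ℝ} (h0 : 0 < p₀) (hp : p₀ ≤ p) (hp' : p₀ ≤ 1 - p) (hη0 : 0 ≤ η)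
    (hη : ∀ N : Finset X, s ≤ N.card → 𝔼 i ∈ I, indicator (N ⊆ St i) ≤ η)
    {f : (X → Bool) → Bool} (hf : ∀ x, f x = true → HasCertificate f r x) :
    𝔼 i ∈ I, ∑ G, bernoulliWeight p G *
      indicator (∃ x, ¬ HasCertificate (fun y => f ((St i).piecewise y G)) s x) ≤
      switchingBound r s p₀ η := by
  have hW := bernoulliWeight_nonneg (X := X) (p := p) (by linarith) (by linarith)
  let dec : (Fin s → Advice r) → (X → Bool) → Finset X := fun l z => decodeVars f (List.ofFn l) z
  calc _ ≤ 𝔼 i ∈ I, ∑ G, bernoulliWeight p G * ∑ l : Fin s → Advice r, ∑ z,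
        indicator (s ≤ (dec l z).card) * indicator (dec l z ⊆ St i) *
          indicator (∀ e ∉ dec l z, G e = z e) := by
        refine Finset.expect_le_expect fun i _ => Finset.sum_le_sum fun G _ =>
          mul_le_mul_of_nonneg_left ?_ (hW G)
        have hpos : ∀ l z, 0 ≤ indicator (s ≤ (dec l z).card) * indicator (dec l z ⊆ St i) *
            indicator (∀ e ∉ dec l z, G e = z e) := fun l z =>
          mul_nonneg (mul_nonneg (indicator_nonneg _) (indicator_nonneg _)) (indicator_nonneg _)
        by_cases hbad : ∃ x, ¬ HasCertificate (fun y => f ((St i).piecewise y G)) s x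
        · rw [indicator_of hbad]
          obtain ⟨l, z, hG, hS, hs⟩ := exists_encoding hf hbad
          refine le_trans ?_ (Finset.single_le_sum (f := fun l => ∑ z,
            indicator (s ≤ (dec l z).card) * indicator (dec l z ⊆ St i) *
            indicator (∀ e ∉ dec l z, G e = z e))
            (fun _ _ => Finset.sum_nonneg fun _ _ => hpos _ _) (Finset.mem_univ l))
          refine le_trans ?_ (Finset.single_le_sum (f := fun z =>
            indicator (s ≤ (dec l z).card) * indicator (dec l z ⊆ St i) *
            indicator (∀ e ∉ dec l z, G e = z e))
            (fun _ _ => hpos _ _) (Finset.mem_univ z))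
          rw [indicator_of hs, indicator_of hS, indicator_of hG]
          norm_num
        · rw [indicator_of_not hbad]
          exact Finset.sum_nonneg fun _ _ => Finset.sum_nonneg fun _ _ => hpos _ _
    -- The decoded set depends on `l` and `z` only, so the averages over the free set and over `G`
    -- factor.
    _ = ∑ l : Fin s → Advice r, ∑ z, indicator (s ≤ (dec l z).card) *
          ((𝔼 i ∈ I, indicator (dec l z ⊆ St i)) *
          ∑ G, bernoulliWeight p G * indicator (∀ e ∉ dec l z, G e = z e)) := by
        have h1 : ∀ i, (∑ G, bernoulliWeight p G * ∑ l : Fin s → Advice r, ∑ z,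
            indicator (s ≤ (dec l z).card) *
              indicator (dec l z ⊆ St i) *
              indicator (∀ e ∉ dec l z, G e = z e)) =
            ∑ l : Fin s → Advice r, ∑ z, indicator (s ≤ (dec l z).card) *
              (indicator (dec l z ⊆ St i) * ∑ G, bernoulliWeight p G *
                indicator (∀ e ∉ dec l z, G e = z e)) := by
          intro i
          simp_rw [Finset.mul_sum]
          rw [Finset.sum_comm]
          refine Finset.sum_congr rfl fun l _ => ?_
          rw [Finset.sum_comm]
          exact Finset.sum_congr rfl fun z _ => Finset.sum_congr rfl fun G _ => by ring
        simp_rw [h1]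
        rw [Finset.expect_sum_comm]
        refine Finset.sum_congr rfl fun l _ => ?_
        rw [Finset.expect_sum_comm]
        refine Finset.sum_congr rfl fun z _ => ?_
        rw [Finset.expect_mul, Finset.mul_expect]
    _ ≤ ∑ l : Fin s → Advice r, ∑ z, η * ((2 / p₀) ^ (r * s) * bernoulliWeight p z) := by
        refine Finset.sum_le_sum fun l _ => Finset.sum_le_sum fun z _ => ?_
        have h2 : 1 ≤ 2 / p₀ := by rw [le_div_iff₀ h0]; linarith
        by_cases hs : s ≤ (dec l z).card
        · rw [indicator_of hs, one_mul]
          refine mul_le_mul (hη _ hs) ((sum_bernoulliWeight_agree_le h0 hp hp' _ z).trans ?_)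
            (Finset.sum_nonneg fun G _ => mul_nonneg (hW G) (indicator_nonneg _)) hη0
          refine mul_le_mul_of_nonneg_right (pow_le_pow_right₀ h2 ?_) (hW z)
          simpa using card_decodeVars_le f (List.ofFn l) z
        · rw [indicator_of_not hs, zero_mul]
          exact mul_nonneg hη0 (mul_nonneg (by positivity) (hW z))
    _ = _ := by
        simp_rw [← Finset.mul_sum, sum_bernoulliWeight]
        simp [switchingBound]
        ring

end ProductWeight

/-! ### Uniformly random subsets of fixed size -/

section RandomSubset

variable {α : Type} [DecidableEq α]

/-- A random `c`-subset of a random `b`-subset is a random `c`-subset. -/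
theorem expect_powersetCard_tower (V : Finset α) {b c : ℕ} (hb : b ≤ V.card) (hc : c ≤ b)
    (f : Finset α → ℝ) :
    𝔼 B ∈ V.powersetCard b, 𝔼 A ∈ B.powersetCard c, f A = 𝔼 A ∈ V.powersetCard c, f A := by
  have h1 : ∀ B ∈ V.powersetCard b, 𝔼 A ∈ B.powersetCard c, f A =
      (∑ A ∈ B.powersetCard c, f A) / (b.choose c : ℝ) := fun B hB => by
    rw [Finset.expect_eq_sum_div_card, Finset.card_powersetCard, (Finset.mem_powersetCard.1 hB).2]
  rw [Finset.expect_congr rfl h1, Finset.expect_eq_sum_div_card, Finset.expect_eq_sum_div_card,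
    Finset.card_powersetCard, Finset.card_powersetCard, ← Finset.sum_div]
  have h2 : ∑ B ∈ V.powersetCard b, ∑ A ∈ B.powersetCard c, f A =
      ((V.card - c).choose (b - c) : ℝ) * ∑ A ∈ V.powersetCard c, f A := by
    rw [Finset.sum_comm' (s' := fun A => (V.powersetCard b).filter (A ⊆ ·))
      (t' := V.powersetCard c), Finset.mul_sum]
    · refine Finset.sum_congr rfl fun A hA => ?_
      obtain ⟨hAV, hAc⟩ := Finset.mem_powersetCard.1 hA
      rw [Finset.sum_const, Finset.card_filter_powersetCard_subset A V b hAV (by omega), hAc,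
        nsmul_eq_mul]
    · intro B A
      simp only [Finset.mem_powersetCard, Finset.mem_filter]
      exact ⟨fun h => ⟨⟨h.1, h.2.1⟩, h.2.1.trans h.1.1, h.2.2⟩, fun h => ⟨h.1.1, h.1.2, h.2.2⟩⟩
  have h3 : ((V.card.choose b : ℝ)) * b.choose c = V.card.choose c *
      (V.card - c).choose (b - c) := by exact_mod_cast Nat.choose_mul hc
  have p1 : (0 : ℝ) < V.card.choose b := by exact_mod_cast Nat.choose_pos hb
  have p2 : (0 : ℝ) < b.choose c := by exact_mod_cast Nat.choose_pos hc
  have p3 : (0 : ℝ) < V.card.choose c := by exact_mod_cast Nat.choose_pos (hc.trans hb)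
  rw [h2, div_div, div_eq_div_iff (by positivity) p3.ne']
  linear_combination (-∑ A ∈ V.powersetCard c, f A) * h3

/-- The ratio of the binomials is the product of (b-i)/(N-i) over i < t, and each factor is at most
b/N. -/
theorem choose_sub_mul_pow_le {N b : ℕ} (hb : b ≤ N) (t : ℕ) (ht : t ≤ b) :
    (N - t).choose (b - t) * N ^ t ≤ N.choose b * b ^ t := by
  induction t with
  | zero => simp
  | succ t ih =>
    have h1 : (N - (t + 1)).choose (b - (t + 1)) * (N - t) = (N - t).choose (b - t) * (b - t) := by
      have h := Nat.add_one_mul_choose_eq (N - (t + 1)) (b - (t + 1))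
      rw [show N - (t + 1) + 1 = N - t by omega, show b - (t + 1) + 1 = b - t by omega] at h
      rw [mul_comm, h]
    have h2 : (b - t) * N ≤ b * (N - t) := by
      obtain ⟨u, rfl⟩ := Nat.exists_eq_add_of_le (show t ≤ b by omega)
      obtain ⟨w, rfl⟩ := Nat.exists_eq_add_of_le hb
      rw [show t + u - t = u by omega, show t + u + w - t = u + w by omega]
      nlinarith [Nat.zero_le (t * w)]
    have h3 : (N - (t + 1)).choose (b - (t + 1)) * N ≤ (N - t).choose (b - t) * b := by
      refine Nat.le_of_mul_le_mul_right ?_ (show 0 < N - t by omega)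
      calc _ = (N - t).choose (b - t) * ((b - t) * N) := by rw [mul_right_comm, h1]; ring
        _ ≤ (N - t).choose (b - t) * (b * (N - t)) := Nat.mul_le_mul_left _ h2
        _ = _ := by ring
    calc _ = ((N - (t + 1)).choose (b - (t + 1)) * N) * N ^ t := by ring
      _ ≤ ((N - t).choose (b - t) * b) * N ^ t := Nat.mul_le_mul_right _ h3
      _ = ((N - t).choose (b - t) * N ^ t) * b := by ring
      _ ≤ (N.choose b * b ^ t) * b := Nat.mul_le_mul_right _ (ih (by omega))
      _ = _ := by ring

theorem expect_subset_le (V T : Finset α) {b : ℕ} {ρ : ℝ} (hb : b ≤ V.card)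
    (hρ : (b : ℝ) ≤ ρ * V.card) (hρ0 : 0 ≤ ρ) :
    𝔼 B ∈ V.powersetCard b, indicator (T ⊆ B) ≤ ρ ^ T.card := by
  by_cases h : T ⊆ V ∧ T.card ≤ b
  · simp only [indicator_eq_ite]
    rw [Finset.expect_eq_sum_div_card, Finset.sum_boole, Finset.card_powersetCard,
      Finset.card_filter_powersetCard_subset T V b h.1 h.2,
      div_le_iff₀ (by exact_mod_cast Nat.choose_pos hb)]
    rcases Nat.eq_zero_or_pos V.card with h0 | h0
    · have hT : T.card = 0 := by omega
      simp [hT]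
    have hV : (0 : ℝ) < V.card := by exact_mod_cast h0
    have h1 : ((V.card - T.card).choose (b - T.card) : ℝ) * (V.card : ℝ) ^ T.card ≤
        V.card.choose b * (b : ℝ) ^ T.card := by
      exact_mod_cast choose_sub_mul_pow_le hb T.card h.2
    refine le_of_mul_le_mul_right (h1.trans ?_) (pow_pos hV T.card)
    calc (V.card.choose b : ℝ) * (b : ℝ) ^ T.card ≤ V.card.choose b * (ρ * V.card) ^ T.card := by
          gcongr
      _ = _ := by rw [mul_pow]; ring
  · have h0 : 𝔼 B ∈ V.powersetCard b, indicator (T ⊆ B) = 0 := by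
      refine Finset.expect_eq_zero fun B hB => indicator_of_not fun hTB => h ?_
      obtain ⟨h1, h2⟩ := Finset.mem_powersetCard.1 hB
      exact ⟨hTB.trans h1, h2 ▸ Finset.card_le_card hTB⟩
    rw [h0]
    positivity

end RandomSubset

/-! ### Edges inside a random vertex set -/

section Edges

variable {n : ℕ}

/-- The potential edges inside `V`. -/
def edgesWithin (V : Finset (Fin n)) : Finset (PotentialEdge n) :=
  Finset.univ.filter fun e => ∀ v ∈ e.1, v ∈ V

theorem mem_edgesWithin {V : Finset (Fin n)} {e : PotentialEdge n} :
    e ∈ edgesWithin V ↔ ∀ v ∈ e.1, v ∈ V := by simp [edgesWithin]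

theorem edgesWithin_mono {V W : Finset (Fin n)} (h : V ⊆ W) : edgesWithin V ⊆ edgesWithin W :=
  fun _ he => mem_edgesWithin.2 fun v hv => h (mem_edgesWithin.1 he v hv)

/-- The end vertices of a set of edges. -/
def endVertices (N : Finset (PotentialEdge n)) : Finset (Fin n) :=
  Finset.univ.filter fun v => ∃ e ∈ N, v ∈ e.1

theorem subset_edgesWithin_iff {N : Finset (PotentialEdge n)} {V : Finset (Fin n)} :
    N ⊆ edgesWithin V ↔ endVertices N ⊆ V := by
  simp only [Finset.subset_iff, mem_edgesWithin, endVertices, Finset.mem_filter, Finset.mem_univ,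
    true_and]
  exact ⟨fun h v ⟨e, he, hv⟩ => h he v hv, fun h e he v hv => h ⟨e, he, hv⟩⟩

theorem card_le_card_endVertices_sq (N : Finset (PotentialEdge n)) :
    N.card ≤ (endVertices N).card ^ 2 := by
  have h1 : N.card ≤ (endVertices N).sym2.card := by
    refine Finset.card_le_card_of_injOn (fun e => e.1) (fun e he => ?_)
      Subtype.val_injective.injOn
    refine Finset.mem_coe.2 (Finset.mem_sym2_iff.2 fun v hv => ?_)
    simp only [endVertices, Finset.mem_filter, Finset.mem_univ, true_and]
    exact ⟨e, he, hv⟩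
  rw [Finset.card_sym2, Nat.choose_two_right] at h1
  refine h1.trans (Nat.div_le_of_le_mul ?_)
  rw [Nat.add_sub_cancel]
  rcases Nat.eq_zero_or_pos (endVertices N).card with h | h
  · simp [h]
  · nlinarith

/-- A set of τ² edges has at least τ end vertices, all of which must fall into the random set. -/
theorem expect_subset_edgesWithin_le (V : Finset (Fin n)) {b τ : ℕ} {ρ : ℝ} (hb : b ≤ V.card)
    (hρ : (b : ℝ) ≤ ρ * V.card) (hρ0 : 0 ≤ ρ) (hρ1 : ρ ≤ 1) (N : Finset (PotentialEdge n))
    (hN : τ ^ 2 ≤ N.card) :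
    𝔼 B ∈ V.powersetCard b, indicator (N ⊆ edgesWithin B) ≤ ρ ^ τ := by
  simp_rw [subset_edgesWithin_iff]
  refine (expect_subset_le V _ hb hρ hρ0).trans (pow_le_pow_of_le_one hρ0 hρ1 ?_)
  exact (Nat.pow_le_pow_iff_left two_ne_zero).1 (hN.trans (card_le_card_endVertices_sq N))

end Edges

/-! ### One layer of gates under a random restriction -/

section Stage

variable {X : Type}

/-- The function computed by a gate after the variables in `F` were set to true. -/
def gateFunction (C : BoolCircuit X) (F : X → Bool) (g : Fin C.size) (x : X → Bool) : Bool :=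
  C.gateValue (fun e => F e || x e) g

/-- All gates of depth at most `i` have small certificates once the variables outside `S` are
set according to `G`. -/
def IsTame [DecidableEq X] (C : BoolCircuit X) (F : X → Bool) (r i : ℕ) (S : Finset X)
    (G : X → Bool) : Prop :=
  ∀ g, C.gateDepth g ≤ i → ∀ x, HasCertificate (fun y => gateFunction C F g (S.piecewise y G)) r x

variable [DecidableEq X] {C : BoolCircuit X} {F : X → Bool} {r i : ℕ} {S : Finset X} {G : X → Bool}

theorem hasCertificate_of_var {g : Fin C.size} {e : X} (hg : C.gate g = .var e)
    (hr : 1 ≤ r) (x : X → Bool) :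
    HasCertificate (fun y => gateFunction C F g (S.piecewise y G)) r x := by
  refine ⟨fun _ => e, fun y hy => ?_⟩
  have h := hy ⟨0, hr⟩
  simp only [gateFunction, C.gateValue_eq _ g, hg]
  by_cases he : e ∈ S <;> simp [he, h]

omit [DecidableEq X] in
theorem hasCertificate_of_const [Nonempty X] {f : (X → Bool) → Bool} (hf : ∀ x y, f x = f y)
    (x : X → Bool) : HasCertificate f r x :=
  ⟨fun _ => Classical.arbitrary X, fun y _ => hf y x⟩

theorem isTame_zero [Nonempty X] (hr : 1 ≤ r) : IsTame C F r 0 S G := by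
  intro g hg x
  have hin : (C.gate g).inputs = ∅ := by
    rw [C.gateDepth_eq] at hg
    by_contra h
    obtain ⟨a, ha⟩ := Finset.nonempty_iff_ne_empty.2 h
    have := Finset.le_sup (f := fun h => C.gateDepth h + 1) ha
    omega
  cases hC : C.gate g with
  | var e => exact hasCertificate_of_var hC hr x
  | const b => exact hasCertificate_of_const (fun _ _ => by simp [gateFunction, C.gateValue_eq _ g, hC]) x
  | neg h => simp [hC, BoolGate.inputs] at hin
  | conj T =>
    have hT : T = ∅ := by simpa [hC, BoolGate.inputs] using hin
    exact hasCertificate_of_const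
      (fun _ _ => by simp [gateFunction, C.gateValue_eq _ g, hC, hT]) x
  | disj T =>
    have hT : T = ∅ := by simpa [hC, BoolGate.inputs] using hin
    exact hasCertificate_of_const
      (fun _ _ => by simp [gateFunction, C.gateValue_eq _ g, hC, hT]) x

/-- One more layer of gates gives functions with small one-sided certificates. -/
theorem IsTame.succ_gate [Nonempty X] (hr : 1 ≤ r) (h : IsTame C F r i S G) {g : Fin C.size}
    (hg : C.gateDepth g ≤ i + 1) :
    ∃ b : Bool, ∀ x, gateFunction C F g (S.piecewise x G) = b →
      HasCertificate (fun y => gateFunction C F g (S.piecewise y G)) r x := by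
  have hin : ∀ a ∈ (C.gate g).inputs, C.gateDepth a ≤ i := fun a ha => by
    rw [C.gateDepth_eq] at hg
    have := (Finset.le_sup (f := fun h => C.gateDepth h + 1) ha).trans hg
    omega
  cases hC : C.gate g with
  | var e => exact ⟨true, fun x _ => hasCertificate_of_var hC hr x⟩
  | const b =>
    exact ⟨true, fun x _ => hasCertificate_of_const
      (fun _ _ => by simp [gateFunction, C.gateValue_eq _ g, hC]) x⟩
  | neg a =>
    refine ⟨true, fun x _ => ?_⟩
    have h1 := (h a (hin a (by simp [hC, BoolGate.inputs])) x).not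
    simpa [gateFunction, C.gateValue_eq _ g, hC] using h1
  | conj T =>
    -- A certificate for one false conjunct certifies that the conjunction is false; its size does
    -- not grow. Disjunctions are dual.
    refine ⟨false, fun x hx => ?_⟩
    have hval : ∀ y, gateFunction C F g (S.piecewise y G) = true ↔
        ∀ a ∈ T, gateFunction C F a (S.piecewise y G) = true := fun y => by
      simp [gateFunction, C.gateValue_eq _ g, hC]
    rw [← Bool.not_eq_true, hval] at hx
    push Not at hx
    obtain ⟨a, ha, hax⟩ := hx
    obtain ⟨v, hv⟩ := h a (hin a (by simpa [hC, BoolGate.inputs] using ha)) x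
    have key : ∀ y, (∀ j, y (v j) = x (v j)) → gateFunction C F g (S.piecewise y G) = false := by
      intro y hy
      rw [← Bool.not_eq_true, hval]
      exact fun hall => hax ((hv y hy).symm.trans (hall a ha))
    exact ⟨v, fun y hy => (key y hy).trans (key x fun _ => rfl).symm⟩
  | disj T =>
    refine ⟨true, fun x hx => ?_⟩
    have hval : ∀ y, gateFunction C F g (S.piecewise y G) = true ↔
        ∃ a ∈ T, gateFunction C F a (S.piecewise y G) = true := fun y => by
      simp [gateFunction, C.gateValue_eq _ g, hC]
    rw [hval] at hx
    obtain ⟨a, ha, hax⟩ := hx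
    obtain ⟨v, hv⟩ := h a (hin a (by simpa [hC, BoolGate.inputs] using ha)) x
    have key : ∀ y, (∀ j, y (v j) = x (v j)) → gateFunction C F g (S.piecewise y G) = true := by
      intro y hy
      rw [hval]
      exact ⟨a, ha, (hv y hy).trans hax⟩
    exact ⟨v, fun y hy => (key y hy).trans (key x fun _ => rfl).symm⟩

theorem piecewise_piecewise_of_subset {S S' : Finset X} (h : S' ⊆ S) (y G₁ G₂ : X → Bool) :
    S'.piecewise y (S.piecewise G₂ G₁) = S.piecewise (S'.piecewise y G₂) G₁ := by
  funext e
  by_cases h1 : e ∈ S'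
  · simp [h1, h h1]
  · by_cases h2 : e ∈ S <;> simp [h1, h2]

/-- Union bound over the gates of the next layer: the old restriction makes each one-sidedly
certified, and the switching lemma is applied to the fresh assignment `G'` on `S`. -/
theorem expect_not_isTame_succ_le [Fintype X] [Nonempty X] (hr : 1 ≤ r) (h : IsTame C F r i S G)
    {ι : Type} (I : Finset ι) (St : ι → Finset X) (hSt : ∀ j ∈ I, St j ⊆ S)
    {η p p₀ : ℝ} (h0 : 0 < p₀) (hp : p₀ ≤ p) (hp' : p₀ ≤ 1 - p) (hη0 : 0 ≤ η)
    (hη : ∀ N : Finset X, r ≤ N.card → 𝔼 i ∈ I, indicator (N ⊆ St i) ≤ η) :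
    𝔼 j ∈ I, ∑ G', bernoulliWeight p G' *
      indicator (¬ IsTame C F r (i + 1) (St j) (S.piecewise G' G)) ≤
      C.size * switchingBound r r p₀ η := by
  have hW := bernoulliWeight_nonneg (X := X) (p := p) (by linarith) (by linarith)
  have hK : 0 ≤ switchingBound r r p₀ η := by unfold switchingBound; positivity
  let f : Fin C.size → (X → Bool) → Bool := fun g y => gateFunction C F g (S.piecewise y G)
  let bad : Fin C.size → ι → (X → Bool) → ℝ := fun g j G' =>
    indicator (∃ x, ¬ HasCertificate (fun y => f g ((St j).piecewise y G')) r x)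
  let L : Finset (Fin C.size) := Finset.univ.filter fun g => C.gateDepth g ≤ i + 1
  have hswitch : ∀ g ∈ L, 𝔼 j ∈ I, ∑ G', bernoulliWeight p G' * bad g j G' ≤
      switchingBound r r p₀ η := by
    intro g hg
    obtain ⟨b, hb⟩ := h.succ_gate hr (Finset.mem_filter.1 hg).2
    cases b with
    | true => exact switching_lemma I St h0 hp hp' hη0 hη hb
    | false =>
      -- Certificates do not distinguish a function from its negation, so the other side is treated
      -- by negating.
      have h1 := switching_lemma I St h0 hp hp' hη0 hη (f := fun y => !f g y)
        (fun x hx => (hb x (by simpa [f] using hx)).not)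
      have h2 : ∀ j G', (∃ x, ¬ HasCertificate (fun y => !f g ((St j).piecewise y G')) r x) ↔
          ∃ x, ¬ HasCertificate (fun y => f g ((St j).piecewise y G')) r x := fun j G' =>
        exists_congr fun x => not_congr ⟨fun h => by simpa using h.not, fun h => h.not⟩
      simp_rw [h2] at h1
      exact h1
  calc _ ≤ 𝔼 j ∈ I, ∑ G', bernoulliWeight p G' * ∑ g ∈ L, bad g j G' := by
        refine Finset.expect_le_expect fun j hj => Finset.sum_le_sum fun G' _ =>
          mul_le_mul_of_nonneg_left ?_ (hW G')
        have hbad0 : ∀ g, 0 ≤ bad g j G' := fun g => indicator_nonneg _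
        by_cases hT : ¬ IsTame C F r (i + 1) (St j) (S.piecewise G' G)
        · rw [indicator_of hT]
          simp only [IsTame, not_forall] at hT
          obtain ⟨g, hg, x, hx⟩ := hT
          simp_rw [piecewise_piecewise_of_subset (hSt j hj)] at hx
          refine le_trans (le_of_eq ?_) (Finset.single_le_sum (f := fun g => bad g j G')
            (fun g _ => hbad0 g) (Finset.mem_filter.2 ⟨Finset.mem_univ g, hg⟩))
          exact (indicator_of ⟨x, hx⟩).symm
        · rw [indicator_of_not hT]
          exact Finset.sum_nonneg fun g _ => hbad0 g
    _ = ∑ g ∈ L, 𝔼 j ∈ I, ∑ G', bernoulliWeight p G' * bad g j G' := by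
        rw [← Finset.expect_sum_comm]
        refine Finset.expect_congr rfl fun j _ => ?_
        simp_rw [Finset.mul_sum]
        exact Finset.sum_comm
    _ ≤ ∑ g ∈ L, switchingBound r r p₀ η := Finset.sum_le_sum hswitch
    _ = L.card * switchingBound r r p₀ η := by rw [Finset.sum_const, nsmul_eq_mul]
    _ ≤ _ := by
        refine mul_le_mul_of_nonneg_right ?_ hK
        exact_mod_cast (Finset.card_le_univ L).trans_eq (Fintype.card_fin _)

end Stage

/-! ### The chain of restrictions and the planted clique -/

section Chain

variable {n : ℕ}

/-- The probability that the gates of depth at most `i` do not all have small certificates after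
a random restriction that leaves the edges inside a random `b`-set of vertices free. -/
noncomputable def notTameProb (C : BoolCircuit (PotentialEdge n)) (F : PotentialEdge n → Bool)
    (r : ℕ) (p : ℝ) (i b : ℕ) : ℝ :=
  𝔼 V ∈ (Finset.univ : Finset (Fin n)).powersetCard b, ∑ G, bernoulliWeight p G *
    indicator (¬ IsTame C F r i (edgesWithin V) G)

theorem powersetCard_nonempty_of_le {V : Finset (Fin n)} {b : ℕ} (h : b ≤ V.card) :
    (V.powersetCard b).Nonempty := Finset.powersetCard_nonempty.2 h

theorem sum_bernoulliWeight_mul_le_one {p : ℝ} (h0 : 0 ≤ p) (h1 : p ≤ 1)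
    (P : (PotentialEdge n → Bool) → Prop) : ∑ G, bernoulliWeight p G * indicator (P G) ≤ 1 := by
  rw [← sum_bernoulliWeight (X := PotentialEdge n) p]
  exact Finset.sum_le_sum fun G _ =>
    mul_le_of_le_one_right (bernoulliWeight_nonneg h0 h1 G) (indicator_le_one _)

variable [Nonempty (PotentialEdge n)] {C : BoolCircuit (PotentialEdge n)}
  {F : PotentialEdge n → Bool} {τ : ℕ} {p p₀ ρ : ℝ}

/-- The smaller vertex set is drawn inside the larger one, and the edges inside the larger set are
resampled. Neither changes the law, but now the new stage is independent of the old one. -/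
theorem notTameProb_succ_le (hτ : 1 ≤ τ) (h0 : 0 < p₀) (hp : p₀ ≤ p) (hp' : p₀ ≤ 1 - p)
    (hρ0 : 0 ≤ ρ) (hρ1 : ρ ≤ 1) {b b' : ℕ} (hb : b ≤ n) (hb' : b' ≤ b) (hρ : (b' : ℝ) ≤ ρ * b)
    (i : ℕ) :
    notTameProb C F (τ ^ 2) p (i + 1) b' ≤ notTameProb C F (τ ^ 2) p i b +
      C.size * switchingBound (τ ^ 2) (τ ^ 2) p₀ (ρ ^ τ) := by
  have hp0 : 0 ≤ p := by linarith
  have hp1 : p ≤ 1 := by linarith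
  have hbn : b ≤ (Finset.univ : Finset (Fin n)).card := by simpa using hb
  set K : ℝ := C.size * switchingBound (τ ^ 2) (τ ^ 2) p₀ (ρ ^ τ) with hK
  have hK0 : 0 ≤ K := by rw [hK, switchingBound]; positivity
  rw [notTameProb, ← expect_powersetCard_tower _ hbn hb']
  have hV : ∀ V ∈ (Finset.univ : Finset (Fin n)).powersetCard b,
      𝔼 V' ∈ V.powersetCard b', ∑ G, bernoulliWeight p G *
        indicator (¬ IsTame C F (τ ^ 2) (i + 1) (edgesWithin V') G) ≤
      (∑ G, bernoulliWeight p G * indicator (¬ IsTame C F (τ ^ 2) i (edgesWithin V) G)) + K := by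
    intro V hV
    have hVc : V.card = b := (Finset.mem_powersetCard.1 hV).2
    have h1 : ∀ V', (∑ G, bernoulliWeight p G *
        indicator (¬ IsTame C F (τ ^ 2) (i + 1) (edgesWithin V') G)) =
        ∑ G, bernoulliWeight p G * ∑ G', bernoulliWeight p G' *
        indicator (¬ IsTame C F (τ ^ 2) (i + 1) (edgesWithin V')
          ((edgesWithin V).piecewise G' G)) := fun V' =>
      (sum_bernoulliWeight_piecewise p (edgesWithin V) _).symm
    simp_rw [h1]
    rw [Finset.expect_sum_comm]
    have h2 : (∑ G : PotentialEdge n → Bool, bernoulliWeight p G *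
        indicator (¬ IsTame C F (τ ^ 2) i (edgesWithin V) G)) + K =
        ∑ G : PotentialEdge n → Bool, bernoulliWeight p G *
          (indicator (¬ IsTame C F (τ ^ 2) i (edgesWithin V) G) + K) := by
      simp_rw [mul_add]
      rw [Finset.sum_add_distrib, ← Finset.sum_mul, sum_bernoulliWeight, one_mul]
    rw [h2]
    refine Finset.sum_le_sum fun G _ => ?_
    rw [← Finset.mul_expect]
    refine mul_le_mul_of_nonneg_left ?_ (bernoulliWeight_nonneg hp0 hp1 G)
    by_cases hT : IsTame C F (τ ^ 2) i (edgesWithin V) G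
    · rw [indicator_of_not (not_not.2 hT), zero_add]
      refine expect_not_isTame_succ_le (Nat.one_le_pow _ _ hτ) hT _ edgesWithin
        (fun V' hV' => edgesWithin_mono (Finset.mem_powersetCard.1 hV').1) h0 hp hp'
        (pow_nonneg hρ0 _) fun N hN => ?_
      exact expect_subset_edgesWithin_le V (hb'.trans_eq hVc.symm) (by rwa [hVc]) hρ0 hρ1 N hN
    · rw [indicator_of hT]
      refine (Finset.expect_le (powersetCard_nonempty_of_le (hb'.trans_eq hVc.symm)) fun V' _ =>
        sum_bernoulliWeight_mul_le_one hp0 hp1 _).trans (by linarith)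
  refine (Finset.expect_le_expect hV).trans_eq ?_
  rw [Finset.expect_add_distrib, Finset.expect_const (powersetCard_nonempty_of_le hbn), notTameProb]

theorem notTameProb_le (hτ : 1 ≤ τ) (h0 : 0 < p₀) (hp : p₀ ≤ p) (hp' : p₀ ≤ 1 - p)
    (hρ0 : 0 ≤ ρ) (hρ1 : ρ ≤ 1) (b : ℕ → ℕ) (hb0 : b 0 = n) (hanti : ∀ i, b (i + 1) ≤ b i)
    (hρ : ∀ i, (b (i + 1) : ℝ) ≤ ρ * b i) (i : ℕ) :
    notTameProb C F (τ ^ 2) p i (b i) ≤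
      i * (C.size * switchingBound (τ ^ 2) (τ ^ 2) p₀ (ρ ^ τ)) := by
  induction i with
  | zero =>
    refine le_of_eq ?_
    rw [Nat.cast_zero, zero_mul, notTameProb]
    refine Finset.expect_eq_zero fun V _ => Finset.sum_eq_zero fun G _ => ?_
    rw [indicator_of_not (not_not.2 (isTame_zero (Nat.one_le_pow _ _ hτ))), mul_zero]
  | succ i ih =>
    have hbn : b i ≤ n := hb0 ▸ antitone_nat_of_succ_le hanti (Nat.zero_le i)
    refine (notTameProb_succ_le hτ h0 hp hp' hρ0 hρ1 hbn (hanti i) (hρ i) i).trans ?_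
    push_cast
    linarith

/-- The assignment after planting a clique on `A`. -/
def plantAssignment (x : PotentialEdge n → Bool) (A : Finset (Fin n)) : PotentialEdge n → Bool :=
  fun e => x e || decide (e ∈ edgesWithin A)

-- In the tame case the output has a certificate of r edges. Each lies inside `A` with probability
-- at most ρ, and if none does, planting is not noticed.
omit [Nonempty (PotentialEdge n)] in
theorem expect_planted_ne_le_of_restricted (hp0 : 0 ≤ p) (hp1 : p ≤ 1)
    (hρ0 : 0 ≤ ρ) (hρ1 : ρ ≤ 1) {b c r d : ℕ} (hd : C.depth ≤ d) (hb : b ≤ n) (hc : c ≤ b)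
    (hρ : (c : ℝ) ≤ ρ * b) :
    𝔼 A ∈ (Finset.univ : Finset (Fin n)).powersetCard c, ∑ G, bernoulliWeight p G *
      indicator (gateFunction C F C.output G ≠ gateFunction C F C.output (plantAssignment G A)) ≤
      notTameProb C F r p d b + r * ρ := by
  have hbn : b ≤ (Finset.univ : Finset (Fin n)).card := by simpa using hb
  rw [← expect_powersetCard_tower _ hbn hc]
  have hV : ∀ V ∈ (Finset.univ : Finset (Fin n)).powersetCard b,
      𝔼 A ∈ V.powersetCard c, ∑ G, bernoulliWeight p G * indicator
        (gateFunction C F C.output G ≠ gateFunction C F C.output (plantAssignment G A)) ≤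
      (∑ G, bernoulliWeight p G * indicator (¬ IsTame C F r d (edgesWithin V) G)) + r * ρ := by
    intro V hV
    have hVc : V.card = b := (Finset.mem_powersetCard.1 hV).2
    rw [Finset.expect_sum_comm]
    have h2 : (∑ G : PotentialEdge n → Bool, bernoulliWeight p G *
        indicator (¬ IsTame C F r d (edgesWithin V) G)) + r * ρ =
        ∑ G : PotentialEdge n → Bool, bernoulliWeight p G *
          (indicator (¬ IsTame C F r d (edgesWithin V) G) + r * ρ) := by
      simp_rw [mul_add]
      rw [Finset.sum_add_distrib, ← Finset.sum_mul, sum_bernoulliWeight, one_mul]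
    rw [h2]
    refine Finset.sum_le_sum fun G _ => ?_
    rw [← Finset.mul_expect]
    refine mul_le_mul_of_nonneg_left ?_ (bernoulliWeight_nonneg hp0 hp1 G)
    by_cases hT : IsTame C F r d (edgesWithin V) G
    · rw [indicator_of_not (not_not.2 hT), zero_add]
      -- The certificate is taken at the input `G`: the graph that fixes the outer edges also
      -- supplies the values of the free ones.
      obtain ⟨v, hv⟩ := hT C.output
        ((Finset.le_sup (f := C.gateDepth) (Finset.mem_univ C.output)).trans hd) G
      calc _ ≤ 𝔼 A ∈ V.powersetCard c, ∑ j : Fin r, indicator ({v j} ⊆ edgesWithin A) := by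
            refine Finset.expect_le_expect fun A hA => ?_
            by_cases hne : gateFunction C F C.output G ≠
              gateFunction C F C.output (plantAssignment G A)
            · rw [indicator_of hne]
              obtain ⟨j, hj⟩ : ∃ j, v j ∈ edgesWithin A := by
                by_contra! hcon
                refine hne ?_
                have h1 := hv (plantAssignment G A) fun j => by simp [plantAssignment, hcon j]
                have h3 : (edgesWithin V).piecewise (plantAssignment G A) G =
                    plantAssignment G A := by
                  funext e
                  by_cases he : e ∈ edgesWithin V
                  · simp [he]
                  · have heA : e ∉ edgesWithin A := fun h =>
                      he (edgesWithin_mono (Finset.mem_powersetCard.1 hA).1 h)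
                    simp [he, plantAssignment, heA]
                simp only [h3, Finset.piecewise_same] at h1
                exact h1.symm
              refine le_trans (le_of_eq ?_) (Finset.single_le_sum
                (f := fun j => indicator ({v j} ⊆ edgesWithin A))
                (fun _ _ => indicator_nonneg _) (Finset.mem_univ j))
              exact (indicator_of (by simpa using hj)).symm
            · rw [indicator_of_not hne]
              exact Finset.sum_nonneg fun _ _ => indicator_nonneg _
        _ = ∑ j : Fin r, 𝔼 A ∈ V.powersetCard c, indicator ({v j} ⊆ edgesWithin A) :=
            Finset.expect_sum_comm _ _ _
        _ ≤ ∑ j : Fin r, ρ ^ 1 := Finset.sum_le_sum fun j _ =>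
            expect_subset_edgesWithin_le V (hc.trans_eq hVc.symm) (by rwa [hVc]) hρ0 hρ1 {v j}
              (by simp)
        _ = r * ρ := by simp
    · rw [indicator_of hT]
      have : 0 ≤ (r : ℝ) * ρ := by positivity
      exact (Finset.expect_le (powersetCard_nonempty_of_le (hc.trans_eq hVc.symm)) fun A _ =>
        indicator_le_one _).trans (by linarith)
  refine (Finset.expect_le_expect hV).trans_eq ?_
  rw [Finset.expect_add_distrib, Finset.expect_const (powersetCard_nonempty_of_le hbn), notTameProb]

/-- Quantitative form of the theorem: a small circuit of depth `d` does not notice a planted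
clique. -/
theorem expect_planted_ne_le {q p' : ℝ} (hτ : 1 ≤ τ) (h0 : 0 < p₀) (hp : p₀ ≤ p')
    (hp' : p₀ ≤ 1 - p') (hq0 : 0 ≤ q) (hq1 : q ≤ 1) (hq : 1 - p = (1 - q) * (1 - p'))
    (hρ0 : 0 ≤ ρ) (hρ1 : ρ ≤ 1) (b : ℕ → ℕ) (hb0 : b 0 = n) (hanti : ∀ i, b (i + 1) ≤ b i)
    (hρ : ∀ i, (b (i + 1) : ℝ) ≤ ρ * b i) {c d : ℕ} (hd : C.depth ≤ d) (hc : c ≤ b d)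
    (hcρ : (c : ℝ) ≤ ρ * b d) :
    𝔼 A ∈ (Finset.univ : Finset (Fin n)).powersetCard c, ∑ G, bernoulliWeight p G *
      indicator (C.eval G ≠ C.eval (plantAssignment G A)) ≤
      d * (C.size * switchingBound (τ ^ 2) (τ ^ 2) p₀ (ρ ^ τ)) + (τ ^ 2 : ℕ) * ρ := by
  have hbn : b d ≤ n := hb0 ▸ antitone_nat_of_succ_le hanti (Nat.zero_le d)
  have h1 : ∀ A, (∑ G, bernoulliWeight p G *
      indicator (C.eval G ≠ C.eval (plantAssignment G A))) =
      ∑ F, bernoulliWeight q F * ∑ G, bernoulliWeight p' G *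
        indicator (gateFunction C F C.output G ≠
          gateFunction C F C.output (plantAssignment G A)) := fun A => by
    rw [← sum_bernoulliWeight_or hq]
    refine Finset.sum_congr rfl fun F _ => ?_
    congr 1
    refine Finset.sum_congr rfl fun G _ => ?_
    -- Planting is itself a union of edge sets, so it commutes with adding `F`.
    have h2 : plantAssignment (fun e => F e || G e) A = fun e => F e || plantAssignment G A e := by
      funext e
      simp [plantAssignment, Bool.or_assoc]
    rw [h2]
    rfl
  simp_rw [h1]
  rw [Finset.expect_sum_comm]
  simp_rw [← Finset.mul_expect]
  calc _ ≤ ∑ F : PotentialEdge n → Bool, bernoulliWeight q F *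
        (d * (C.size * switchingBound (τ ^ 2) (τ ^ 2) p₀ (ρ ^ τ)) + (τ ^ 2 : ℕ) * ρ) := by
        refine Finset.sum_le_sum fun F _ => mul_le_mul_of_nonneg_left ?_
          (bernoulliWeight_nonneg hq0 hq1 F)
        refine (expect_planted_ne_le_of_restricted (r := τ ^ 2) (by linarith) (by linarith) hρ0 hρ1
          hd hbn hc hcρ).trans ?_
        gcongr
        exact notTameProb_le hτ h0 hp hp' hρ0 hρ1 b hb0 hanti hρ d
    _ = _ := by rw [← Finset.sum_mul, sum_bernoulliWeight, one_mul]

end Chain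

/-! ### Translating the random graph into Bernoulli weights -/

section Law

variable {n : ℕ}

theorem graphAssignment_injective : Function.Injective (graphAssignment (n := n)) := by
  intro G G' h
  rw [← SimpleGraph.edgeSet_inj]
  ext e
  by_cases he : e.IsDiag
  · exact iff_of_false (fun h => G.not_isDiag_of_mem_edgeSet h he)
      (fun h => G'.not_isDiag_of_mem_edgeSet h he)
  · have := congrFun h ⟨e, he⟩
    simpa [graphAssignment] using this

theorem graphAssignment_bijective : Function.Bijective (graphAssignment (n := n)) := by
  refine ⟨graphAssignment_injective, fun x => ?_⟩
  refine ⟨SimpleGraph.fromEdgeSet {e | ∃ h : ¬ e.IsDiag, x ⟨e, h⟩ = true}, funext fun e => ?_⟩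
  have he := e.2
  rw [Bool.eq_iff_iff]
  simp [graphAssignment, he]

theorem graphAssignment_plantClique (G : SimpleGraph (Fin n)) (A : Finset (Fin n)) :
    graphAssignment (plantClique G A) = plantAssignment (graphAssignment G) A := by
  funext e
  obtain ⟨e, he⟩ := e
  induction e using Sym2.ind with
  | _ u v =>
    have huv : u ≠ v := by simpa using he
    have h : (plantClique G A).Adj u v ↔ G.Adj u v ∨ u ∈ A ∧ v ∈ A := by
      simp [plantClique, huv]
    rw [Bool.eq_iff_iff]
    simp [graphAssignment, plantAssignment, mem_edgesWithin, h]

theorem binomialRandom_real_singleton (p : unitInterval) (G : SimpleGraph (Fin n)) :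
    (SimpleGraph.binomialRandom (Fin n) p).real {G} =
      bernoulliWeight (p : ℝ) (graphAssignment G) := by
  classical
  have hcard : (Finset.univ.filter fun e : PotentialEdge n => graphAssignment G e = true).card =
      G.edgeSet.ncard := by
    rw [← Set.ncard_coe_finset, ← Set.ncard_image_of_injective _ Subtype.val_injective]
    congr 1
    ext e
    simp only [graphAssignment, Set.mem_image, Finset.coe_filter, Finset.mem_univ, true_and,
      Set.mem_ofPred_eq, decide_eq_true_eq]
    exact ⟨fun ⟨a, h, ha⟩ => ha ▸ h, fun h => ⟨⟨e, G.not_isDiag_of_mem_edgeSet h⟩, h, rfl⟩⟩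
  have hX : Fintype.card (PotentialEdge n) = n.choose 2 := by
    rw [Sym2.card_subtype_not_diag, Fintype.card_fin]
  have hcard' : (Finset.univ.filter fun e : PotentialEdge n => ¬ graphAssignment G e = true).card =
      n.choose 2 - G.edgeSet.ncard := by
    rw [Finset.filter_not, Finset.card_sdiff_of_subset (Finset.filter_subset _ _), hcard,
      Finset.card_univ, hX]
  rw [measureReal_def, SimpleGraph.binomialRandom_singleton, bernoulliWeight]
  simp only [bitWeight]
  rw [Finset.prod_ite, Finset.prod_const, Finset.prod_const, hcard, hcard']
  simp

instance : MeasurableSingletonClass (SimpleGraph (Fin n)) where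
  measurableSet_singleton G := by
    rw [← SimpleGraph.measurableEmbedding_edgeSet.measurableSet_image, Set.image_singleton]
    exact MeasurableSet.singleton _

theorem uniformOn_card_real_singleton (c : ℕ) (A : Finset (Fin n)) :
    (uniformOn {A : Finset (Fin n) | A.card = c}).real {A} =
      if A.card = c then ((n.choose c : ℕ) : ℝ)⁻¹ else 0 := by
  classical
  have h : {A : Finset (Fin n) | A.card = c} =
      (((Finset.univ : Finset (Fin n)).powersetCard c : Finset (Finset (Fin n))) :
        Set (Finset (Fin n))) := by
    ext A; simp
  rw [measureReal_def, h, ← Finset.coe_singleton, uniformOn_apply_finset,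
    Finset.card_powersetCard, Finset.card_univ, Fintype.card_fin]
  split_ifs with hA
  · rw [Finset.inter_singleton_of_mem (by simp [hA])]
    simp
  · rw [Finset.inter_singleton_of_notMem (by simp [hA])]
    simp

/-- The space is finite, so the measure is a sum over singletons, and graphs correspond bijectively
to assignments. -/
theorem plantedLaw_real_eq (p : unitInterval) (c : ℕ)
    (P : (PotentialEdge n → Bool) → (PotentialEdge n → Bool) → Prop) :
    (plantedLaw n p c).real {GA | P (graphAssignment GA.1) (graphAssignment (plantClique GA.1 GA.2))}
      = 𝔼 A ∈ (Finset.univ : Finset (Fin n)).powersetCard c, ∑ x, bernoulliWeight (p : ℝ) x *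
        indicator (P x (plantAssignment x A)) := by
  classical
  set S : Finset (SimpleGraph (Fin n) × Finset (Fin n)) := Finset.univ.filter fun GA =>
    P (graphAssignment GA.1) (graphAssignment (plantClique GA.1 GA.2)) with hS
  have h1 : {GA : SimpleGraph (Fin n) × Finset (Fin n) |
      P (graphAssignment GA.1) (graphAssignment (plantClique GA.1 GA.2))} = (S : Set _) := by
    ext; simp [hS]
  have : IsFiniteMeasure (plantedLaw n p c) := by unfold plantedLaw; infer_instance
  rw [h1, ← sum_measureReal_singleton]
  have h2 : ∀ GA : SimpleGraph (Fin n) × Finset (Fin n), (plantedLaw n p c).real {GA} =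
      bernoulliWeight (p : ℝ) (graphAssignment GA.1) *
        if GA.2.card = c then ((n.choose c : ℕ) : ℝ)⁻¹ else 0 := by
    intro GA
    rw [← binomialRandom_real_singleton, ← uniformOn_card_real_singleton, plantedLaw,
      ← measureReal_prod_prod, Set.singleton_prod_singleton]
  simp_rw [h2]
  rw [hS, Finset.sum_filter, Fintype.sum_prod_type_right, Finset.expect_eq_sum_div_card,
    Finset.card_powersetCard, Finset.card_univ, Fintype.card_fin, Finset.sum_div,
    ← Finset.sum_subset (Finset.subset_univ ((Finset.univ : Finset (Fin n)).powersetCard c))]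
  · refine Finset.sum_congr rfl fun A hA => ?_
    rw [← graphAssignment_bijective.sum_comp, Finset.sum_div]
    refine Finset.sum_congr rfl fun G _ => ?_
    rw [← graphAssignment_plantClique, indicator_eq_ite, if_pos (Finset.mem_powersetCard.1 hA).2]
    split_ifs
    · rw [mul_one, div_eq_mul_inv]
    · simp
  · intro A _ hA
    refine Finset.sum_eq_zero fun G _ => ?_
    have : A.card ≠ c := fun h => hA (by simp [h])
    simp [this]

theorem plantedLaw_real_eq_one_sub (p : unitInterval) {c : ℕ} (hc : c ≤ n)
    (C : BoolCircuit (PotentialEdge n)) :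
    (plantedLaw n p c).real {GA : SimpleGraph (Fin n) × Finset (Fin n) |
      C.evalGraph GA.1 = C.evalGraph (plantClique GA.1 GA.2)} =
      1 - 𝔼 A ∈ (Finset.univ : Finset (Fin n)).powersetCard c, ∑ x, bernoulliWeight (p : ℝ) x *
        indicator (C.eval x ≠ C.eval (plantAssignment x A)) := by
  have h1 : (1 : ℝ) = 𝔼 A ∈ (Finset.univ : Finset (Fin n)).powersetCard c,
      ∑ x : PotentialEdge n → Bool, bernoulliWeight (p : ℝ) x := by
    rw [sum_bernoulliWeight, Finset.expect_const (powersetCard_nonempty_of_le (by simpa using hc))]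
  have h2 := plantedLaw_real_eq p c (fun x y => C.eval x = C.eval y)
  rw [eq_sub_iff_add_eq]
  refine (congrArg (· + _) h2).trans ?_
  rw [← Finset.expect_add_distrib, h1]
  refine Finset.expect_congr rfl fun A _ => ?_
  rw [← Finset.sum_add_distrib]
  refine Finset.sum_congr rfl fun x _ => ?_
  by_cases h : C.eval x = C.eval (plantAssignment x A)
  · rw [indicator_of h, indicator_of_not (not_not.2 h)]; ring
  · rw [indicator_of_not h, indicator_of h]; ring

end Law

/-- A real number y ≥ 1 is at most twice its floor, hence the factor 2. Negative exponents occur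
because the chain is indexed by all naturals; then the floor on the left is 0. -/
theorem natFloor_rpow_le_mul {n : ℕ} (hn : 2 ≤ n) {ε x : ℝ} (hε : 0 ≤ ε) :
    (⌊(n : ℝ) ^ (x - ε)⌋₊ : ℝ) ≤ 2 * (n : ℝ) ^ (-ε) * ⌊(n : ℝ) ^ x⌋₊ := by
  have hn0 : (0 : ℝ) < n := by positivity
  have hn1 : (1 : ℝ) < n := by exact_mod_cast hn
  rcases lt_or_ge x 0 with hx | hx
  · have h1 : ⌊(n : ℝ) ^ (x - ε)⌋₊ = 0 :=
      Nat.floor_eq_zero.2 (Real.rpow_lt_one_of_one_lt_of_neg hn1 (by linarith))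
    rw [h1, Nat.cast_zero]
    positivity
  · have h1 : (1 : ℝ) ≤ (n : ℝ) ^ x := Real.one_le_rpow hn1.le hx
    have h2 : (1 : ℝ) ≤ ⌊(n : ℝ) ^ x⌋₊ := by exact_mod_cast Nat.one_le_floor_iff _ |>.2 h1
    have h3 := (Nat.lt_floor_add_one ((n : ℝ) ^ x)).le
    have h4 : (n : ℝ) ^ (x - ε) = (n : ℝ) ^ (-ε) * (n : ℝ) ^ x := by
      rw [← Real.rpow_add hn0]; ring_nf
    refine (Nat.floor_le (by positivity)).trans ?_
    rw [h4, mul_comm (2 : ℝ), mul_assoc]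
    refine mul_le_mul_of_nonneg_left ?_ (by positivity)
    linarith

/-- The powers of n are at most t from the gates, 1 from the change of assignment, and -(t+2) from
the random free set. -/
theorem switchingBound_mul_rpow_le {n t s τ : ℕ} {ε δ : ℝ} (hn : 1 ≤ n) (hδ : δ * (s * s : ℕ) ≤ 1)
    (hτ : t + 2 ≤ ε * τ) {m : ℕ} (hm : m ≤ n ^ t) :
    m * switchingBound s s ((n : ℝ) ^ (-δ)) ((2 * (n : ℝ) ^ (-ε)) ^ τ) ≤
      (Fintype.card (Advice s) : ℝ) ^ s * 2 ^ (s * s) * 2 ^ τ * (n : ℝ) ^ (-1 : ℝ) := by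
  have hn0 : (0 : ℝ) < n := by exact_mod_cast hn
  have hn1 : (1 : ℝ) ≤ n := by exact_mod_cast hn
  have h1 : (2 / (n : ℝ) ^ (-δ)) ^ (s * s) = 2 ^ (s * s) * (n : ℝ) ^ (δ * (s * s : ℕ)) := by
    rw [Real.rpow_neg hn0.le, div_inv_eq_mul, mul_pow, Real.rpow_mul_natCast hn0.le]
  have h2 : (2 * (n : ℝ) ^ (-ε)) ^ τ = 2 ^ τ * (n : ℝ) ^ (-ε * τ) := by
    rw [mul_pow, Real.rpow_mul_natCast hn0.le]
  have h3 : (m : ℝ) ≤ (n : ℝ) ^ (t : ℝ) := by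
    rw [Real.rpow_natCast]; exact_mod_cast hm
  rw [switchingBound, h1, h2]
  calc _ ≤ (n : ℝ) ^ (t : ℝ) * ((Fintype.card (Advice s) : ℝ) ^ s *
        (2 ^ (s * s) * (n : ℝ) ^ (δ * (s * s : ℕ)) * (2 ^ τ * (n : ℝ) ^ (-ε * τ)))) := by gcongr
    _ = (Fintype.card (Advice s) : ℝ) ^ s * 2 ^ (s * s) * 2 ^ τ *
        (n : ℝ) ^ (t + δ * (s * s : ℕ) + -ε * τ) := by
        rw [Real.rpow_add hn0, Real.rpow_add hn0]; ring
    _ ≤ _ := by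
        refine mul_le_mul_of_nonneg_left (Real.rpow_le_rpow_of_exponent_le hn1 ?_) (by positivity)
        linarith

theorem mainTheorem2 (k : ℕ → ℝ) (hk_pos : ∀ n, 0 < k n) (hk : Tendsto k atTop atTop)
    (c : ℕ → ℕ) (ξ : ℝ) (hξ_nonneg : 0 ≤ ξ) (hξ_lt_one : ξ < 1)
    (hc : ∀ n : ℕ, (c n : ℝ) ≤ (n : ℝ) ^ ξ)
    (C : ∀ n : ℕ, BoolCircuit (PotentialEdge n)) (hC : IsACZeroFamily C) :
    Tendsto
      (fun n : ℕ => (plantedLaw n (edgeProb n (k n) (hk_pos n)) (c n)).real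
        {GA : SimpleGraph (Fin n) × Finset (Fin n) |
          (C n).evalGraph GA.1 = (C n).evalGraph (plantClique GA.1 GA.2)})
      atTop (𝓝 1) := by
  obtain ⟨⟨d, hd⟩, t, ht⟩ := hC
  -- There are d shrinking steps for the layers and one more from the last vertex set to `A`,
  -- leading from exponent 1 down to ξ.
  set ε : ℝ := (1 - ξ) / (d + 1) with hε_def
  have hε : 0 < ε := div_pos (by linarith) (by positivity)
  have hεd : ε * (d + 1) = 1 - ξ := div_mul_cancel₀ _ (by positivity)
  obtain ⟨τ, hτ⟩ : ∃ τ : ℕ, (t + 2 : ℝ) / ε ≤ τ := exists_nat_ge _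
  have hτε : (t + 2 : ℝ) ≤ ε * τ := by rwa [div_le_iff₀ hε, mul_comm] at hτ
  have hτ1 : 1 ≤ τ := by
    rw [Nat.one_le_iff_ne_zero]
    rintro rfl
    have : (0 : ℝ) ≤ t := by positivity
    simp only [Nat.cast_zero, mul_zero] at hτε
    linarith
  set s : ℕ := τ ^ 2 with hs
  have hs1 : 1 ≤ s := Nat.one_le_pow _ _ hτ1
  have hss : (0 : ℝ) < (s * s : ℕ) := by exact_mod_cast Nat.mul_pos hs1 hs1
  set δ : ℝ := 1 / (s * s : ℕ) with hδ_def
  have hδ : 0 < δ := by positivity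
  have hδs : δ * (s * s : ℕ) ≤ 1 := (div_mul_cancel₀ _ hss.ne').le
  set K : ℝ := (Fintype.card (Advice s) : ℝ) ^ s * 2 ^ (s * s) * 2 ^ τ with hK
  have hlim : ∀ a : ℝ, 0 < a → Tendsto (fun n : ℕ => (n : ℝ) ^ (-a)) atTop (𝓝 0) := fun a ha =>
    (tendsto_rpow_neg_atTop ha).comp tendsto_natCast_atTop_atTop
  have hcn : ∀ n : ℕ, 1 ≤ n → c n ≤ n := fun n hn => by
    have h1 : (n : ℝ) ^ ξ ≤ (n : ℝ) ^ (1 : ℝ) :=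
      Real.rpow_le_rpow_of_exponent_le (by exact_mod_cast hn) hξ_lt_one.le
    rw [Real.rpow_one] at h1
    exact_mod_cast (hc n).trans h1
  have hbound : ∀ᶠ n : ℕ in atTop,
      1 - (d * (K * (n : ℝ) ^ (-1 : ℝ)) + s * (2 * (n : ℝ) ^ (-ε))) ≤
        (plantedLaw n (edgeProb n (k n) (hk_pos n)) (c n)).real
          {GA : SimpleGraph (Fin n) × Finset (Fin n) |
            (C n).evalGraph GA.1 = (C n).evalGraph (plantClique GA.1 GA.2)} := by
    filter_upwards [ht, eventually_ge_atTop 2, hk.eventually_ge_atTop (1 / δ),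
      (hlim ε hε).eventually_le_const (show (0 : ℝ) < 1 / 2 by norm_num),
      (hlim δ hδ).eventually_le_const (show (0 : ℝ) < 1 / 2 by norm_num)]
      with n hsize hn hkn hρ1 hp2
    have hn1 : (1 : ℝ) ≤ n := by exact_mod_cast (by omega : 1 ≤ n)
    have hn0 : (0 : ℝ) < n := by linarith
    have : Nonempty (PotentialEdge n) :=
      ⟨⟨s(⟨0, by omega⟩, ⟨1, by omega⟩), by simp⟩⟩
    set b : ℕ → ℕ := fun i => ⌊(n : ℝ) ^ (1 - i * ε)⌋₊ with hb
    have hcb : (c n : ℝ) ≤ (n : ℝ) ^ (1 - d * ε - ε) := by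
      have : 1 - d * ε - ε = ξ := by linarith
      rw [this]
      exact hc n
    have hcb' : (c n : ℝ) ≤ ⌊(n : ℝ) ^ (1 - d * ε - ε)⌋₊ := by
      exact_mod_cast Nat.le_floor hcb
    set p : ℝ := (edgeProb n (k n) (hk_pos n) : ℝ) with hp
    have hp1 : p ≤ 1 := (edgeProb n (k n) (hk_pos n)).2.2
    set p' : ℝ := (n : ℝ) ^ (-δ) with hp'
    have hp'0 : 0 < p' := by positivity
    have hpp' : p' ≤ p := by
      refine Real.rpow_le_rpow_of_exponent_le hn1 ?_
      have h1 : 1 / k n ≤ δ := by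
        rw [div_le_iff₀ (hk_pos n)]
        rwa [div_le_iff₀ hδ, mul_comm] at hkn
      rw [neg_div]
      linarith
    have h1p' : 0 < 1 - p' := by linarith
    rw [plantedLaw_real_eq_one_sub _ (hcn n (by omega))]
    refine sub_le_sub_left ?_ 1
    -- This `q` solves 1 - p = (1 - q)(1 - p') and is nonnegative because p' ≤ p, which holds once
    -- k(n) ≥ 1/δ. As p' ≤ 1/2, it can serve as `p₀` as well.
    refine (expect_planted_ne_le (p := p) (p₀ := p') (p' := p') (q := 1 - (1 - p) / (1 - p'))
      (ρ := 2 * (n : ℝ) ^ (-ε)) (d := d) hτ1 hp'0 le_rfl (by linarith) ?_ ?_ ?_ (by positivity)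
      (by linarith) b (by simp [hb]) (fun i => ?_) (fun i => ?_) (hd n) ?_ ?_).trans ?_
    · rw [sub_nonneg, div_le_one h1p']
      linarith
    · have := div_nonneg (sub_nonneg.2 hp1) h1p'.le
      linarith
    · rw [sub_sub_cancel, div_mul_cancel₀ _ h1p'.ne']
    · refine Nat.floor_le_floor (Real.rpow_le_rpow_of_exponent_le hn1 ?_)
      push_cast
      linarith
    · have h := natFloor_rpow_le_mul hn hε.le (x := 1 - i * ε)
      have h2 : 1 - ((i + 1 : ℕ) : ℝ) * ε = 1 - i * ε - ε := by push_cast; ring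
      simpa only [hb, h2] using h
    · exact Nat.le_floor (hcb.trans (Real.rpow_le_rpow_of_exponent_le hn1 (by linarith)))
    · exact hcb'.trans (natFloor_rpow_le_mul hn hε.le)
    · have h := switchingBound_mul_rpow_le (by omega) hδs hτε hsize
      gcongr
  have hlim0 : Tendsto (fun n : ℕ => 1 - ((d : ℝ) * (K * (n : ℝ) ^ (-1 : ℝ)) +
      s * (2 * (n : ℝ) ^ (-ε)))) atTop (𝓝 1) := by
    have h := ((((hlim 1 one_pos).const_mul K).const_mul (d : ℝ)).add
      (((hlim ε hε).const_mul 2).const_mul (s : ℝ))).const_sub 1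
    simpa using h
  refine tendsto_of_tendsto_of_tendsto_of_le_of_le' hlim0 tendsto_const_nhds hbound ?_
  filter_upwards [eventually_ge_atTop 1] with n hn
  rw [plantedLaw_real_eq_one_sub _ (hcn n hn)]
  refine sub_le_self _ (Finset.expect_nonneg fun A _ => Finset.sum_nonneg fun x _ =>
    mul_nonneg (bernoulliWeight_nonneg ?_ ?_ x) (indicator_nonneg _))
  · exact (edgeProb n (k n) (hk_pos n)).2.1
  · exact (edgeProb n (k n) (hk_pos n)).2.2
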